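/- **Conventions.** All graphs are finite and simple. Let $T$ be a tree and $w$ a vertex of $T$. Write $T(w)$ for the forest obtained from $T$ by deleting $w$, and, for a neighbor $v$ of $w$, write $T_v(w)$ for the connected component of $T(w)$ that contains $v$. A component is called odd if it has an odd number of vertices. The tree $T$ on $n$ vertices is *NEB (nearly even branching) at $w$*, a property defined recursively, if either $n=1$, or $n\ge 2$ and (i) $T(w)$ has exactly one odd component if $n$ is even, and no odd component if $n$ is odd; and (ii) for each neighbor $v$ of $w$ in $T$, the tree $T_v(w)$ is NEB at $v$. The graph of an $n\times n$ real skew-symmetric matrix $A=[a_{ij}]$ has vertices $1,\dots,n$, and distinct $i,j$ are adjacent in it if and only if $a_{ij}\neq 0$. $A(v)$ denotes the principal submatrix obtained from $A$ by deleting row and column $v$. **Theorem 3.1.** Let $T$ be a tree on $n\ge 2$ vertices $1,2,\dots,n$. Let $$\lambda_1<\mu_1<\lambda_2<\cdots<\mu_{n-1}<\lambda_n$$ be $2n-1$ real numbers such that $\lambda_j=-\lambda_{n+1-j}$ for all $j=1,\dots,n$ and $\mu_k=-\mu_{n-k}$ for all $k=1,\dots,n-1$. If $T$ is NEB at a vertex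 $v$, then there exists a real skew-symmetric matrix $A$ whose graph is $T$ such that the eigenvalues of $A$ are $\mathrm{i}\lambda_1,\mathrm{i}\lambda_2,\dots,\mathrm{i}\lambda_n$ and the eigenvalues of $A(v)$ are $\mathrm{i}\mu_1,\mathrm{i}\mu_2,\dots,\mathrm{i}\mu_{n-1}$. -/

import Mathlib

/-- The forest `T(w)`, obtained from `T` by deleting the vertex `w`. -/
abbrev SimpleGraph.deleteVertex {V : Type*} (T : SimpleGraph V) (w : V) :
    SimpleGraph ({w}ᶜ : Set V) :=
  T.induce ({w}ᶜ : Set V)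

/-- For a neighbor `v` of `w`, the connected component of `T(w)` that contains `v`. -/
abbrev SimpleGraph.branchComponent {V : Type*} (T : SimpleGraph V) {w v : V} (h : T.Adj w v) :
    (T.deleteVertex w).ConnectedComponent :=
  (T.deleteVertex w).connectedComponentMk ⟨v, h.ne'⟩

/-- The graph `T_v(w)`: the connected component of `T(w)` that contains the neighbor `v` of `w`,
as a graph on its own vertex set. -/
abbrev SimpleGraph.branch {V : Type*} (T : SimpleGraph V) {w v : V} (h : T.Adj w v) :
    SimpleGraph (T.branchComponent h).supp :=
  (T.deleteVertex w).induce (T.branchComponent h).supp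

/-- The vertex `v`, as a vertex of `T_v(w)`. -/
abbrev SimpleGraph.branchRoot {V : Type*} (T : SimpleGraph V) {w v : V} (h : T.Adj w v) :
    (T.branchComponent h).supp :=
  ⟨⟨v, h.ne'⟩, rfl⟩

/-- `T.IsNEB w`: the tree `T` has the nearly even branching property at its vertex `w`.
The property is defined by recursion on the number of vertices. `oddComponents` is the set of
connected components with an odd number of vertices. -/
inductive SimpleGraph.IsNEB.{u} : ∀ {V : Type u}, SimpleGraph V → V → Prop
  | single {V : Type u} (T : SimpleGraph V) (w : V) (hcard : Nat.card V = 1) : IsNEB T w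
  | branching {V : Type u} (T : SimpleGraph V) (w : V) (hcard : 2 ≤ Nat.card V)
      (even_case : Even (Nat.card V) → (T.deleteVertex w).oddComponents.ncard = 1)
      (odd_case : Odd (Nat.card V) → (T.deleteVertex w).oddComponents = ∅)
      (branches : ∀ (v : V) (h : T.Adj w v), IsNEB (T.branch h) (T.branchRoot h)) :
      IsNEB T w

/-- The graph `G(A)` of a (symmetric or skew-symmetric) real matrix `A`: distinct indices `i`, `j`
are adjacent if and only if the `(i, j)` entry (equivalently, the `(j, i)` entry) is nonzero. -/
def Matrix.graphOf {V : Type*} (A : Matrix V V ℝ) : SimpleGraph V :=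
  SimpleGraph.fromRel fun i j => A i j ≠ 0

/-- The set `S⁻(G)` of real skew-symmetric matrices whose graph is exactly `G`. -/
def SimpleGraph.skewMatrices {V : Type*} (G : SimpleGraph V) : Set (Matrix V V ℝ) :=
  {A | A.transpose = -A ∧ A.graphOf = G}

/-- The principal submatrix `A(v)`: row and column `v` are deleted. -/
def Matrix.deleteIndex {V R : Type*} (A : Matrix V V R) (v : V) :
    Matrix {i : V // i ≠ v} {i : V // i ≠ v} R :=
  A.submatrix Subtype.val Subtype.val

/-- The complex eigenvalues of a real square matrix, as a multiset, that is, listed with their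
algebraic multiplicities. -/
noncomputable def Matrix.complexEigenvalues {V : Type*} [Fintype V] [DecidableEq V]
    (A : Matrix V V ℝ) : Multiset ℂ :=
  (A.map Complex.ofReal).charpoly.roots

open Polynomial in
/-- A polynomial of degree less than the number of nodes, in partial fractions over the nodes. -/
theorem Polynomial.eval_eq_prod_mul_sum_div {S : Finset ℝ} {p : ℝ[X]} (hp : p.degree < S.card)
    {y : ℝ} (hy : y ∉ S) :
    p.eval y = (∏ x ∈ S, (y - x)) *
      ∑ x ∈ S, (p.eval x / ∏ x' ∈ S.erase x, (x - x')) / (y - x) := by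
  have h1 := Lagrange.eq_interpolate_of_eval_eq (s := S) (v := id) (f := p)
    (fun x => p.eval x) (Set.injOn_id _) hp (fun i _ => rfl)
  have h2 := Lagrange.eval_interpolate_not_at_node (s := S) (v := id) (x := y)
    (fun x => p.eval x) (fun i hi h => hy (by simpa [h] using hi))
  rw [← h1, Lagrange.eval_nodal] at h2
  rw [h2]
  simp only [id, Lagrange.nodalWeight, Finset.prod_inv_distrib]
  congr 1
  refine Finset.sum_congr rfl fun x _ => ?_
  rw [div_eq_mul_inv, div_eq_mul_inv]
  ring

/-- The resolvent function `∑ c x / (y - x)` is negated under `y ↦ -y` when the data are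
symmetric. -/
theorem Finset.sum_div_neg_sub {S : Finset ℝ} (hS : ∀ x ∈ S, -x ∈ S) {c : ℝ → ℝ}
    (hc : ∀ x ∈ S, c (-x) = c x) (y : ℝ) :
    ∑ x ∈ S, c x / (-y - x) = -∑ x ∈ S, c x / (y - x) := by
  rw [← Finset.sum_neg_distrib]
  refine Finset.sum_bij' (fun x _ => -x) (fun x _ => -x) hS hS (by simp) (by simp) ?_
  intro x hx
  rw [hc x hx, ← div_neg]
  congr 1
  ring

theorem Finset.sum_eq_zero_of_neg_mem {S : Finset ℝ} (hS : ∀ x ∈ S, -x ∈ S) :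
    ∑ x ∈ S, x = 0 := by
  have : ∑ x ∈ S, x = ∑ x ∈ S, -x :=
    Finset.sum_bij' (fun x _ => -x) (fun x _ => -x) hS hS (by simp) (by simp) (by simp)
  rw [Finset.sum_neg_distrib] at this
  linarith

theorem Complex.im_eq_zero_of_sum_div_sub_eq_zero {S : Finset ℝ} (hne : S.Nonempty) {c : ℝ → ℝ}
    (hc : ∀ x ∈ S, 0 < c x) {z : ℂ} (h : ∑ x ∈ S, (c x : ℂ) / (z - x) = 0) : z.im = 0 := by
  by_contra hz
  have him : ∀ x ∈ S, ((c x : ℂ) / (z - x)).im = -z.im * (c x / Complex.normSq (z - x)) := by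
    intro x _
    simp [Complex.div_im]
    ring
  have h1 := congrArg Complex.im h
  rw [Complex.im_sum, Finset.sum_congr rfl him, ← Finset.mul_sum] at h1
  have h2 : 0 < ∑ x ∈ S, c x / Complex.normSq (z - x) := by
    refine Finset.sum_pos (fun x hx => div_pos (hc x hx) (Complex.normSq_pos.2 ?_)) hne
    intro h0
    apply hz
    simpa using congrArg Complex.im h0
  have : -z.im ≠ 0 := neg_ne_zero.2 hz
  simp only [Complex.zero_im, mul_eq_zero, this, h2.ne', or_self] at h1

open Polynomial in
/-- The inverse of a symmetric Stieltjes resolvent of a discrete probability measure on `S`,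
as a symmetric continued fraction step. -/
theorem Finset.exists_inv_resolvent {S : Finset ℝ} (hne : S.Nonempty) (hS : ∀ x ∈ S, -x ∈ S)
    {c : ℝ → ℝ} (hc : ∀ x ∈ S, 0 < c x) (hcs : ∀ x ∈ S, c (-x) = c x) (hc1 : ∑ x ∈ S, c x = 1) :
    ∃ (S' : Finset ℝ) (d : ℝ → ℝ), S'.card + 1 = S.card ∧ (∀ x ∈ S', -x ∈ S') ∧
      (∀ x ∈ S', 0 < d x) ∧ (∀ x, d (-x) = d x) ∧
      ∀ y, y ∉ S → y ∉ S' →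
        ∑ x ∈ S, c x / (y - x) = (∏ x ∈ S', (y - x)) / ∏ x ∈ S, (y - x) ∧
        y - ∑ x ∈ S', d x / (y - x) = (∏ x ∈ S, (y - x)) / ∏ x ∈ S', (y - x) := by
  classical
  obtain ⟨n, hn⟩ : ∃ n, S.card = n + 1 := Nat.exists_eq_succ_of_ne_zero hne.card_pos.ne'
  set g : ℝ[X] := Lagrange.interpolate S id
    (fun x => c x * ∏ x' ∈ S.erase x, (x - x')) with hg
  have hinj : Set.InjOn (id : ℝ → ℝ) S := Set.injOn_id _
  have hpe : ∀ x, ∏ x' ∈ S.erase x, (x - x') ≠ 0 := fun x =>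
    Finset.prod_ne_zero_iff.2 fun x' hx' => sub_ne_zero.2 (Finset.ne_of_mem_erase hx').symm
  have hgS : ∀ x ∈ S, g.eval x = c x * ∏ x' ∈ S.erase x, (x - x') := fun x hx =>
    Lagrange.eval_interpolate_at_node _ hinj hx
  have hgS0 : ∀ x ∈ S, g.eval x ≠ 0 := fun x hx => by
    rw [hgS x hx]
    exact mul_ne_zero (hc x hx).ne' (hpe x)
  have hgdeg : g.degree < S.card := Lagrange.degree_interpolate_lt _ hinj
  have hgdiv : ∀ x ∈ S, g.eval x / ∏ x' ∈ S.erase x, (x - x') = c x := fun x hx => by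
    rw [hgS x hx, mul_div_assoc, div_self (hpe x), mul_one]
  have hgcoeff : g.coeff n = 1 := by
    have := Lagrange.coeff_eq_sum hinj hgdeg
    rw [hn, Nat.add_sub_cancel] at this
    rw [this, ← hc1]
    exact Finset.sum_congr rfl fun x hx => hgdiv x hx
  have hgnat : g.natDegree = n := by
    refine le_antisymm ?_ (Polynomial.le_natDegree_of_ne_zero (by rw [hgcoeff]; exact one_ne_zero))
    have h0 : g ≠ 0 := fun h => by simp [h] at hgcoeff
    rw [Polynomial.degree_eq_natDegree h0, hn] at hgdeg
    exact Nat.lt_succ_iff.1 (by exact_mod_cast hgdeg)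
  have hmonic : g.Monic := by rw [Polynomial.Monic, Polynomial.leadingCoeff, hgnat, hgcoeff]
  have hgy : ∀ y, y ∉ S → g.eval y = (∏ x ∈ S, (y - x)) * ∑ x ∈ S, c x / (y - x) := by
    intro y hy
    rw [Polynomial.eval_eq_prod_mul_sum_div hgdeg hy]
    congr 1
    exact Finset.sum_congr rfl fun x hx => by rw [hgdiv x hx]
  have hfy : ∀ y, y ∉ S → ∏ x ∈ S, (y - x) ≠ 0 := fun y hy =>
    Finset.prod_ne_zero_iff.2 fun x hx => sub_ne_zero.2 fun h => hy (h ▸ hx)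
  have hsplit : g.Splits := by
    refine Polynomial.Splits.of_splits_map Complex.ofRealHom
      (IsAlgClosed.splits _) fun z hz => ?_
    have hz0 : (g.map Complex.ofRealHom).eval z = 0 := (Polynomial.mem_roots'.1 hz).2
    by_cases hzS : ∃ x ∈ S, (x : ℂ) = z
    · obtain ⟨x, _, hx⟩ := hzS
      exact ⟨x, hx⟩
    · have hzS' : ∀ x ∈ S, z - (x : ℂ) ≠ 0 := fun x hx h => hzS ⟨x, hx, (sub_eq_zero.1 h).symm⟩
      have key : (g.map Complex.ofRealHom).eval z =
          (∏ x ∈ S, (z - (x : ℂ))) * ∑ x ∈ S, (c x : ℂ) / (z - x) := by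
        have hg2 : g = ∑ x ∈ S, C (c x) * ∏ x' ∈ S.erase x, (X - C x') := by
          rw [hg, Lagrange.interpolate_apply]
          refine Finset.sum_congr rfl fun x _ => ?_
          rw [Lagrange.basis, C_mul, mul_assoc]
          congr 1
          rw [map_prod, ← Finset.prod_mul_distrib]
          refine Finset.prod_congr rfl fun x' hx' => ?_
          rw [Lagrange.basisDivisor, ← mul_assoc, ← C_mul, id, id, mul_inv_cancel₀, C_1, one_mul]
          exact sub_ne_zero.2 (Finset.ne_of_mem_erase hx').symm
        rw [hg2, Polynomial.map_sum, Polynomial.eval_finsetSum, Finset.mul_sum]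
        refine Finset.sum_congr rfl fun x hx => ?_
        rw [← Finset.mul_prod_erase S _ hx, Polynomial.map_mul, Polynomial.map_prod,
          Polynomial.eval_mul, Polynomial.eval_prod]
        have := hzS' x hx
        simp only [Polynomial.map_sub, Polynomial.map_X, Polynomial.map_C, Polynomial.eval_sub,
          Polynomial.eval_X, Polynomial.eval_C, Complex.ofRealHom_eq_coe]
        field_simp
      rw [key, mul_eq_zero, or_iff_right (Finset.prod_ne_zero_iff.2 hzS')] at hz0
      have him := Complex.im_eq_zero_of_sum_div_sub_eq_zero hne hc hz0
      exact ⟨z.re, Complex.ext rfl (by simp [him])⟩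
  have hroot : ∀ μ, g.eval μ = 0 ↔ μ ∉ S ∧ ∑ x ∈ S, c x / (μ - x) = 0 := by
    intro μ
    constructor
    · intro h
      have hμ : μ ∉ S := fun hS => hgS0 μ hS h
      refine ⟨hμ, ?_⟩
      rw [hgy μ hμ, mul_eq_zero] at h
      exact h.resolve_left (hfy μ hμ)
    · rintro ⟨hμ, h⟩
      rw [hgy μ hμ, h, mul_zero]
  have hsq : ∀ μ, μ ∉ S → 0 < ∑ x ∈ S, c x / (μ - x) ^ 2 := fun μ hμ =>
    Finset.sum_pos (fun x hx => div_pos (hc x hx)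
      (sq_pos_of_ne_zero (sub_ne_zero.2 fun h => hμ (h ▸ hx)))) hne
  have hder : ∀ μ, g.eval μ = 0 → g.derivative.eval μ =
      -((∏ x ∈ S, (μ - x)) * ∑ x ∈ S, c x / (μ - x) ^ 2) := by
    intro μ hμ
    obtain ⟨hμS, hφ⟩ := (hroot μ).1 hμ
    have h1 := g.hasDerivAt μ
    have h2 : HasDerivAt (fun y => ∑ x ∈ S, c x / (y - x)) (∑ x ∈ S, -(c x / (μ - x) ^ 2)) μ := by
      refine HasDerivAt.fun_sum fun x hx => ?_
      have hne0 : μ - x ≠ 0 := sub_ne_zero.2 fun h => hμS (h ▸ hx)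
      have := (hasDerivAt_const μ (c x)).div ((hasDerivAt_id μ).sub_const x) hne0
      refine this.congr_deriv ?_
      simp [neg_div]
    have h3 : HasDerivAt (fun y => (Lagrange.nodal S id).eval y)
        ((Lagrange.nodal S id).derivative.eval μ) μ := (Lagrange.nodal S id).hasDerivAt μ
    have h4 := h3.mul h2
    have hev : (fun y => g.eval y) =ᶠ[nhds μ]
        (fun y => (Lagrange.nodal S id).eval y) * (fun y => ∑ x ∈ S, c x / (y - x)) := by
      have : ∀ᶠ y in nhds μ, y ∉ S :=
        (S.finite_toSet.isClosed.isOpen_compl).mem_nhds hμS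
      filter_upwards [this] with y hy
      simp [Lagrange.eval_nodal, hgy y hy]
    have h5 := h1.unique (h4.congr_of_eventuallyEq hev)
    rw [h5, hφ, mul_zero, zero_add, Lagrange.eval_nodal, Finset.sum_neg_distrib, mul_neg]
    rfl
  have hnodup : g.roots.Nodup := by
    refine Multiset.nodup_iff_count_le_one.2 fun μ => ?_
    rw [Polynomial.count_roots]
    by_contra! h
    obtain ⟨h1, h2⟩ := (Polynomial.one_lt_rootMultiplicity_iff_isRoot hmonic.ne_zero).1 h
    have h3 : g.derivative.eval μ = 0 := h2
    have hμS := ((hroot μ).1 h1).1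
    rw [hder μ h1, neg_eq_zero, mul_eq_zero] at h3
    exact h3.elim (hfy μ hμS) (hsq μ hμS).ne'
  set S' : Finset ℝ := g.roots.toFinset with hS'
  have hmem : ∀ μ, μ ∈ S' ↔ g.eval μ = 0 := fun μ => by
    rw [hS', Multiset.mem_toFinset, Polynomial.mem_roots hmonic.ne_zero, Polynomial.IsRoot]
  have hcard : S'.card = n := by
    rw [hS', Multiset.toFinset_card_of_nodup hnodup, ← hsplit.natDegree_eq_card_roots, hgnat]
  have hprod : g = ∏ x ∈ S', (X - C x) := by
    rw [hS', Finset.prod, Multiset.toFinset_val, hnodup.dedup]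
    exact hsplit.eq_prod_roots_of_monic hmonic
  have hS'neg : ∀ x ∈ S', -x ∈ S' := by
    intro x hx
    rw [hmem, hroot] at hx ⊢
    refine ⟨fun h => hx.1 (by simpa using hS _ h), ?_⟩
    rw [Finset.sum_div_neg_sub hS hcs, hx.2, neg_zero]
  have hpeval : ∀ y, g.eval y = ∏ x ∈ S', (y - x) := fun y => by
    rw [hprod, Polynomial.eval_prod]
    simp
  set f : ℝ[X] := ∏ x ∈ S, (X - C x) with hf
  have hfeval : ∀ y, f.eval y = ∏ x ∈ S, (y - x) := fun y => by
    rw [hf, Polynomial.eval_prod]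
    simp
  have hfm : f.Monic := Polynomial.monic_prod_of_monic _ _ fun x _ => Polynomial.monic_X_sub_C x
  have hfn : f.natDegree = n + 1 := by
    rw [hf, Polynomial.natDegree_prod_of_monic _ _ fun x _ => Polynomial.monic_X_sub_C x]
    simp [hn]
  have hXgm : (X * g).Monic := Polynomial.monic_X.mul hmonic
  have hXgn : (X * g).natDegree = n + 1 := by
    rw [Polynomial.monic_X.natDegree_mul hmonic, hgnat, Polynomial.natDegree_X, add_comm]
  have hfnext : f.coeff n = 0 := by
    have h := Polynomial.prod_X_sub_C_nextCoeff (s := S) (fun x : ℝ => x)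
    rw [Finset.sum_eq_zero_of_neg_mem hS, Polynomial.nextCoeff_of_natDegree_pos (by rw [← hf]; omega),
      ← hf, hfn] at h
    simpa using h
  have hgnext : (X * g).coeff n = 0 := by
    have h : (X * g).nextCoeff = 0 := by
      rw [Polynomial.monic_X.nextCoeff_mul hmonic, hprod,
        Polynomial.prod_X_sub_C_nextCoeff (s := S') (fun x : ℝ => x),
        Finset.sum_eq_zero_of_neg_mem hS'neg]
      simp [Polynomial.nextCoeff]
    rw [Polynomial.nextCoeff_of_natDegree_pos (by omega), hXgn] at h
    simpa using h
  have hrdeg : (X * g - f).degree < (S'.card : WithBot ℕ) := by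
    rw [hcard, Polynomial.degree_lt_iff_coeff_zero]
    intro k hk
    rw [Polynomial.coeff_sub]
    rcases hk.eq_or_lt with rfl | hk
    · rw [hfnext, hgnext, sub_zero]
    · rcases (Nat.succ_le_of_lt hk).eq_or_lt with rfl | hk
      · have h1 := hfm.coeff_natDegree
        have h2 := hXgm.coeff_natDegree
        rw [hfn] at h1
        rw [hXgn] at h2
        rw [Nat.succ_eq_add_one, h1, h2, sub_self]
      · rw [Polynomial.coeff_eq_zero_of_natDegree_lt (by omega),
          Polynomial.coeff_eq_zero_of_natDegree_lt (by omega), sub_self]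
  refine ⟨S', fun μ => (∑ x ∈ S, c x / (μ - x) ^ 2)⁻¹, by rw [hcard, hn], hS'neg,
    fun μ hμ => inv_pos.2 (hsq μ ((hroot μ).1 ((hmem μ).1 hμ)).1), ?_, ?_⟩
  · intro μ
    refine congrArg Inv.inv
      (Finset.sum_bij' (fun x _ => -x) (fun x _ => -x) hS hS (by simp) (by simp) ?_)
    intro x hx
    rw [hcs x hx]
    congr 1
    ring
  · intro y hy hy'
    have hfy0 := hfy y hy
    have hgy0 : ∏ x ∈ S', (y - x) ≠ 0 :=
      Finset.prod_ne_zero_iff.2 fun x hx => sub_ne_zero.2 fun h => hy' (h ▸ hx)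
    refine ⟨?_, ?_⟩
    · rw [eq_div_iff hfy0, mul_comm, ← hgy y hy, hpeval]
    · have hd : ∀ μ ∈ S', (X * g - f).eval μ / ∏ x' ∈ S'.erase μ, (μ - x') =
          (∑ x ∈ S, c x / (μ - x) ^ 2)⁻¹ := by
        intro μ hμ
        have h0 := (hmem μ).1 hμ
        have hμS := ((hroot μ).1 h0).1
        have h1 := hder μ h0
        have h2 : g.derivative.eval μ = ∏ x' ∈ S'.erase μ, (μ - x') := by
          have := Lagrange.eval_nodal_derivative_eval_node_eq (s := S') (v := id) hμ
          rw [Lagrange.eval_nodal] at this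
          rw [hprod]
          exact this
        rw [← h2, h1, Polynomial.eval_sub, Polynomial.eval_mul, h0, hfeval]
        have := hfy μ hμS
        have := (hsq μ hμS).ne'
        field_simp
        ring
      have h := Polynomial.eval_eq_prod_mul_sum_div hrdeg hy'
      rw [Finset.sum_congr rfl fun μ hμ => by rw [hd μ hμ]] at h
      rw [Polynomial.eval_sub, Polynomial.eval_mul, Polynomial.eval_X, hpeval, hfeval] at h
      rw [eq_div_iff hgy0]
      linarith

section

open Matrix

theorem Matrix.det_blockDiagonal'_eq_prod {ι R : Type*} [CommRing R] [Fintype ι] [DecidableEq ι]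
    {V : ι → Type*} [∀ i, Fintype (V i)] [∀ i, DecidableEq (V i)]
    (B : ∀ i, Matrix (V i) (V i) R) : (blockDiagonal' B).det = ∏ i, (B i).det := by
  let : LinearOrder ι := LinearOrder.lift' (Fintype.equivFin ι) (Fintype.equivFin ι).injective
  have h : BlockTriangular (blockDiagonal' B) Sigma.fst := by
    rintro ⟨i, x⟩ ⟨j, y⟩ hij
    exact blockDiagonal'_apply_ne _ _ _ (ne_of_gt hij)
  rw [h.det_fintype]
  refine Finset.prod_congr rfl fun i _ => ?_
  rw [← det_submatrix_equiv_self (Equiv.sigmaSubtype i).symm]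
  congr 1
  ext x y
  exact blockDiagonal'_apply_eq _ _ _ _

/-- The skew-symmetric matrix obtained from the blocks `B i` by joining the vertex `r i` of each
block to a new vertex, with weight `a i`. -/
def Matrix.joinRoots {ι R : Type*} [CommRing R] [DecidableEq ι] {V : ι → Type*}
    [∀ i, DecidableEq (V i)] (r : ∀ i, V i) (a : ι → R) (B : ∀ i, Matrix (V i) (V i) R) :
    Matrix (Unit ⊕ Σ i, V i) (Unit ⊕ Σ i, V i) R :=
  fromBlocks 0 (Matrix.of fun _ p => if p.2 = r p.1 then -a p.1 else 0)
    (Matrix.of fun p _ => if p.2 = r p.1 then a p.1 else 0) (blockDiagonal' B)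

theorem Matrix.joinRoots_map {ι R R' : Type*} [CommRing R] [CommRing R'] [DecidableEq ι]
    {V : ι → Type*} [∀ i, DecidableEq (V i)] {r : ∀ i, V i} (φ : R →+* R') {a : ι → R}
    {B : ∀ i, Matrix (V i) (V i) R} :
    (joinRoots r a B).map φ = joinRoots r (fun i => φ (a i)) fun i => (B i).map φ := by
  rw [joinRoots, fromBlocks_map, joinRoots]
  congr 1
  · ext; simp
  · ext p q
    simp only [map_apply, of_apply]
    split_ifs <;> simp
  · ext p q
    simp only [map_apply, of_apply]
    split_ifs <;> simp
  · rw [blockDiagonal'_map _ _ (map_zero φ)]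

section

variable {ι : Type*} [Fintype ι] [DecidableEq ι] {V : ι → Type*}
    [∀ i, Fintype (V i)] [∀ i, DecidableEq (V i)] {r : ∀ i, V i}

theorem Matrix.joinRoots_transpose {ι R : Type*} [CommRing R] [DecidableEq ι] {V : ι → Type*}
    [∀ i, DecidableEq (V i)] {r : ∀ i, V i} {a : ι → R}
    {B : ∀ i, Matrix (V i) (V i) R} (hB : ∀ i, (B i)ᵀ = -B i) :
    (joinRoots r a B)ᵀ = -joinRoots r a B := by
  rw [joinRoots, fromBlocks_transpose, fromBlocks_neg, blockDiagonal'_transpose,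
    ← blockDiagonal'_neg]
  congr 1
  · simp
  · ext p q
    simp only [transpose_apply, of_apply, neg_apply]
    split_ifs <;> simp
  · ext p q
    simp only [transpose_apply, of_apply, neg_apply]
    split_ifs <;> simp
  · exact congrArg _ (funext hB)

variable {K : Type*} [Field K]

theorem Matrix.det_and_inv_smul_one_sub_joinRoots {a : ι → K} {B : ∀ i, Matrix (V i) (V i) K}
    (z : K) (hB : ∀ i, (z • (1 : Matrix (V i) (V i) K) - B i).det ≠ 0) {s : K}
    (hs : s = z + ∑ i, a i ^ 2 * (z • (1 : Matrix (V i) (V i) K) - B i)⁻¹ (r i) (r i)) :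
    (z • (1 : Matrix (Unit ⊕ Σ i, V i) (Unit ⊕ Σ i, V i) K) - joinRoots r a B).det =
      (∏ i, (z • (1 : Matrix (V i) (V i) K) - B i).det) * s ∧
    (s ≠ 0 → (z • (1 : Matrix (Unit ⊕ Σ i, V i) (Unit ⊕ Σ i, V i) K) - joinRoots r a B)⁻¹
      (Sum.inl ()) (Sum.inl ()) = s⁻¹) := by
  set D : ∀ i, Matrix (V i) (V i) K := fun i => z • (1 : Matrix (V i) (V i) K) - B i with hD
  set b : Matrix Unit (Σ i, V i) K := Matrix.of fun _ p => if p.2 = r p.1 then a p.1 else 0 with hb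
  have hM : z • (1 : Matrix (Unit ⊕ Σ i, V i) (Unit ⊕ Σ i, V i) K) - joinRoots r a B =
      fromBlocks (z • 1) b (-bᵀ) (blockDiagonal' D) := by
    rw [joinRoots, ← fromBlocks_one, fromBlocks_smul, sub_eq_add_neg, fromBlocks_neg, fromBlocks_add]
    congr 1
    · simp
    · ext p q
      simp only [hb, of_apply, add_apply, smul_apply, zero_apply, neg_apply]
      split_ifs <;> simp
    · ext p q
      simp only [hb, of_apply, add_apply, smul_apply, zero_apply, transpose_apply, neg_apply]
      split_ifs <;> simp
    · rw [← blockDiagonal'_one, ← blockDiagonal'_smul, ← blockDiagonal'_neg,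
        ← blockDiagonal'_add]
      congr 1
      funext i
      exact (sub_eq_add_neg _ _).symm
  have hDinv : blockDiagonal' D * blockDiagonal' (fun i => (D i)⁻¹) = 1 := by
    rw [← blockDiagonal'_mul, ← blockDiagonal'_one]
    congr 1
    funext i
    exact mul_nonsing_inv _ (isUnit_iff_ne_zero.2 (hB i))
  let : Invertible (blockDiagonal' D) := invertibleOfRightInverse _ _ hDinv
  have hinvOf : ⅟(blockDiagonal' D) = blockDiagonal' (fun i => (D i)⁻¹) :=
    invOf_eq_right_inv hDinv
  have hschur : (z • 1 : Matrix Unit Unit K) - b * ⅟(blockDiagonal' D) * (-bᵀ) =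
      Matrix.of fun _ _ => s := by
    have hbD : ∀ (u : Unit) (p : Σ i, V i), (b * ⅟(blockDiagonal' D)) u p =
        a p.1 * (D p.1)⁻¹ (r p.1) p.2 := by
      rintro u ⟨i, y⟩
      rw [hinvOf, mul_apply, Fintype.sum_sigma, Finset.sum_eq_single i]
      · simp [hb, blockDiagonal'_apply_eq]
      · intro j _ hj
        exact Finset.sum_eq_zero fun x _ => by rw [blockDiagonal'_apply_ne _ _ _ hj, mul_zero]
      · simp
    ext ⟨⟩ ⟨⟩
    rw [hs, Matrix.mul_neg, sub_neg_eq_add, add_apply, mul_apply, Fintype.sum_sigma]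
    simp only [hbD]
    simp only [smul_apply, one_apply_eq, smul_eq_mul, mul_one, of_apply, transpose_apply, hb,
      mul_ite, mul_zero, Finset.sum_ite_eq', Finset.mem_univ, if_true]
    congr 1
    exact Finset.sum_congr rfl fun i _ => by simp only [hD]; ring
  have hdet : (fromBlocks (z • 1) b (-bᵀ) (blockDiagonal' D)).det = (∏ i, (D i).det) * s := by
    rw [det_fromBlocks₂₂, det_blockDiagonal'_eq_prod, hschur, det_unique, of_apply]
  rw [hM]
  refine ⟨hdet, fun hs0 => ?_⟩
  have hone : (Matrix.of fun _ _ => s : Matrix Unit Unit K) * Matrix.of (fun _ _ => s⁻¹) = 1 := by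
    ext
    simp [mul_apply, hs0]
  let : Invertible ((z • 1 : Matrix Unit Unit K) - b * ⅟(blockDiagonal' D) * (-bᵀ)) :=
    invertibleOfRightInverse _ (Matrix.of fun _ _ => s⁻¹) (by rw [hschur, hone])
  let := fromBlocks₂₂Invertible (z • 1 : Matrix Unit Unit K) b (-bᵀ) (blockDiagonal' D)
  rw [← invOf_eq_nonsing_inv, invOf_fromBlocks₂₂_eq, fromBlocks_apply₁₁]
  rfl

end

theorem Matrix.det_deleteIndex {V K : Type*} [Fintype V] [DecidableEq V] [Field K]
    (M : Matrix V V K) (hM : M.det ≠ 0) (v : V) :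
    (M.deleteIndex v).det = M.det * M⁻¹ v v := by
  have h1 : M.det * M⁻¹ v v = M.adjugate v v := by
    rw [inv_def, smul_apply, Ring.inverse_eq_inv', smul_eq_mul, mul_inv_cancel_left₀ hM]
  rw [h1, adjugate_apply, twoBlockTriangular_det _ (fun i => i ≠ v)]
  · have h2 : (toSquareBlockProp (M.updateRow v (Pi.single v 1)) fun i => i ≠ v) =
        M.deleteIndex v := by
      ext i j
      exact congrFun (updateRow_ne i.2) _
    have h3 : (toSquareBlockProp (M.updateRow v (Pi.single v 1)) fun i => ¬i ≠ v) = 1 := by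
      ext ⟨i, hi⟩ ⟨j, hj⟩
      obtain rfl := not_not.1 hi
      obtain rfl := not_not.1 hj
      simp [toSquareBlockProp]
    rw [h2, h3, det_one, mul_one]
  · intro i hi j hj
    rw [not_not.1 hi, updateRow_self, Pi.single_eq_of_ne hj]

end

/-- A symmetric set of reals can be distributed into symmetric parts of prescribed sizes, as soon as
the parity of the sizes allows it. -/
theorem Finset.exists_symmetric_coloring {ι : Type*} [Fintype ι] [DecidableEq ι] (n : ι → ℕ)
    {S : Finset ℝ} (hS : ∀ x ∈ S, -x ∈ S) (hcard : ∑ i, n i = S.card)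
    (hodd : Odd S.card → ∃ i₀, ∀ i, Odd (n i) ↔ i = i₀)
    (heven : Even S.card → ∀ i, Even (n i)) :
    ∃ S' : ι → Finset ℝ, (∀ i, (S' i).card = n i) ∧ (∀ i, ∀ x ∈ S' i, -x ∈ S' i) ∧
      (Set.univ : Set ι).PairwiseDisjoint S' ∧ Finset.univ.biUnion S' = S := by
  classical
  set P : Finset ℝ := S.filter (0 < ·) with hP
  set N : Finset ℝ := S.filter (· < 0) with hN
  set Z : Finset ℝ := S.filter (· = 0) with hZ
  have hPN : N = P.image (fun x => -x) := by
    ext x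
    simp only [hN, hP, Finset.mem_filter, Finset.mem_image]
    constructor
    · rintro ⟨h1, h2⟩
      exact ⟨-x, ⟨hS x h1, by linarith⟩, neg_neg x⟩
    · rintro ⟨y, ⟨h1, h2⟩, rfl⟩
      exact ⟨hS y h1, by linarith⟩
  have hNcard : N.card = P.card := by
    rw [hPN, Finset.card_image_of_injective _ neg_injective]
  have hsplit : S.card = 2 * P.card + Z.card := by
    have h1 : S = (P ∪ N) ∪ Z := by
      ext x
      simp only [hN, hP, hZ, Finset.mem_union, Finset.mem_filter]
      rcases lt_trichotomy x 0 with h | h | h <;> tauto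
    have h2 : Disjoint P N := Finset.disjoint_filter.2 fun x _ h => by linarith
    have h3 : Disjoint (P ∪ N) Z := by
      rw [Finset.disjoint_left]
      simp only [hN, hP, hZ, Finset.mem_union, Finset.mem_filter]
      rintro x (h | h) h' <;> linarith [h.2, h'.2]
    rw [h1, Finset.card_union_of_disjoint h3, Finset.card_union_of_disjoint h2, hNcard, two_mul]
  have hZle : Z.card ≤ 1 := Finset.card_le_one.2 fun x hx y hy => by
    rw [(Finset.mem_filter.1 hx).2, (Finset.mem_filter.1 hy).2]
  have hZ' : ∃ T : ι → Finset ℝ, (∀ i, (T i).card = n i % 2) ∧ (∀ i, T i ⊆ Z) ∧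
      (∀ i j, ∀ x ∈ T i, x ∈ T j → i = j) ∧ ∀ x ∈ Z, ∃ i, x ∈ T i := by
    rcases Nat.even_or_odd S.card with h | h
    · have hn := heven h
      have : Z = ∅ := by
        rw [← Finset.card_eq_zero]
        obtain ⟨k, hk⟩ := h
        omega
      exact ⟨fun _ => ∅, fun i => by simp [Nat.even_iff.1 (hn i)], by simp, by simp,
        by simp [this]⟩
    · obtain ⟨i₀, hi₀⟩ := hodd h
      have : Z.card = 1 := by
        obtain ⟨k, hk⟩ := h
        omega
      refine ⟨fun i => if i = i₀ then Z else ∅, fun i => ?_, fun i => ?_, fun i j x hi hj => ?_,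
        fun x hx => ⟨i₀, by simpa using hx⟩⟩
      · beta_reduce
        split_ifs with hi
        · rw [this, Nat.odd_iff.1 ((hi₀ i).2 hi)]
        · have := Nat.even_iff.1 (Nat.not_odd_iff_even.1 (mt (hi₀ i).1 hi))
          simp [this]
      · beta_reduce
        split_ifs <;> simp
      · beta_reduce at hi hj
        split_ifs at hi hj with h1 h2 <;> simp_all
  obtain ⟨T, hTcard, hTZ, hTdisj, hTcov⟩ := hZ'
  have hPcard : P.card = ∑ i, n i / 2 := by
    have h1 : ∑ i, n i % 2 = Z.card := by
      have : Z = Finset.univ.biUnion T := by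
        ext x
        simp only [Finset.mem_biUnion, Finset.mem_univ, true_and]
        exact ⟨hTcov x, fun ⟨i, hi⟩ => hTZ i hi⟩
      rw [this, Finset.card_biUnion]
      · exact Finset.sum_congr rfl fun i _ => (hTcard i).symm
      · intro i _ j _ hij
        exact Finset.disjoint_left.2 fun x hi hj => hij (hTdisj i j x hi hj)
    have h2 : ∑ i, n i = 2 * ∑ i, n i / 2 + ∑ i, n i % 2 := by
      rw [Finset.mul_sum, ← Finset.sum_add_distrib]
      exact Finset.sum_congr rfl fun i _ => by omega
    omega
  have e : P ≃ Σ i, Fin (n i / 2) := Fintype.equivOfCardEq (by simp [hPcard])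
  set Q : ι → Finset ℝ := fun i => Finset.univ.image fun k : Fin (n i / 2) => (e.symm ⟨i, k⟩ : ℝ)
    with hQ
  have hQmem : ∀ i x, x ∈ Q i ↔ ∃ h : x ∈ P, (e ⟨x, h⟩).1 = i := by
    intro i x
    simp only [hQ, Finset.mem_image, Finset.mem_univ, true_and]
    constructor
    · rintro ⟨k, rfl⟩
      exact ⟨(e.symm ⟨i, k⟩).2, by simp⟩
    · rintro ⟨h, rfl⟩
      exact ⟨(e ⟨x, h⟩).2, by simp⟩
  have hQcard : ∀ i, (Q i).card = n i / 2 := by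
    intro i
    rw [hQ, Finset.card_image_of_injective, Finset.card_univ, Fintype.card_fin]
    intro k l hkl
    have := e.symm.injective (Subtype.ext hkl)
    simpa using this
  have hQpos : ∀ i x, x ∈ Q i → x ∈ S ∧ 0 < x := fun i x hx =>
    Finset.mem_filter.1 ((hQmem i x).1 hx).1
  have hTzero : ∀ i x, x ∈ T i → x ∈ S ∧ x = 0 := fun i x hx =>
    Finset.mem_filter.1 (hTZ i hx)
  have hQdisj : ∀ i j x, x ∈ Q i → x ∈ Q j → i = j := by
    intro i j x hi hj
    obtain ⟨h, rfl⟩ := (hQmem i x).1 hi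
    obtain ⟨h', rfl⟩ := (hQmem j x).1 hj
    rfl
  have hmem : ∀ i x, x ∈ (Q i ∪ (Q i).image (fun x => -x)) ∪ T i ↔
      x ∈ Q i ∨ -x ∈ Q i ∨ x ∈ T i := by
    intro i x
    simp only [Finset.mem_union, Finset.mem_image, or_assoc, neg_eq_iff_eq_neg, exists_eq_right]
  refine ⟨fun i => (Q i ∪ (Q i).image (fun x => -x)) ∪ T i, fun i => ?_, fun i x => ?_, ?_, ?_⟩
  · rw [Finset.card_union_of_disjoint, Finset.card_union_of_disjoint,
      Finset.card_image_of_injective _ neg_injective, hQcard, hTcard]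
    · omega
    · rw [Finset.disjoint_left]
      intro x hx hx'
      obtain ⟨y, hy, rfl⟩ := Finset.mem_image.1 hx'
      linarith [(hQpos i _ hx).2, (hQpos i _ hy).2]
    · rw [Finset.disjoint_left]
      intro x hx hx'
      have h0 := (hTzero i x hx').2
      rcases Finset.mem_union.1 hx with hx | hx
      · linarith [(hQpos i _ hx).2]
      · obtain ⟨y, hy, rfl⟩ := Finset.mem_image.1 hx
        linarith [(hQpos i _ hy).2]
  · rw [hmem, hmem, neg_neg]
    rintro (h | h | h)
    · exact Or.inr (Or.inl h)
    · exact Or.inl h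
    · have h0 := (hTzero i x h).2
      subst h0
      simpa using Or.inr h
  · intro i _ j _ hij
    refine Finset.disjoint_left.2 fun x hi hj => hij ?_
    rw [hmem] at hi hj
    rcases hi with h | h | h <;> rcases hj with h' | h' | h'
    · exact hQdisj i j _ h h'
    · linarith [(hQpos i _ h).2, (hQpos j _ h').2]
    · linarith [(hQpos i _ h).2, (hTzero j _ h').2]
    · linarith [(hQpos i _ h).2, (hQpos j _ h').2]
    · exact hQdisj i j _ h h'
    · linarith [(hQpos i _ h).2, (hTzero j _ h').2]
    · linarith [(hTzero i _ h).2, (hQpos j _ h').2]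
    · linarith [(hTzero i _ h).2, (hQpos j _ h').2]
    · exact hTdisj i j _ h h'
  · ext x
    simp only [Finset.mem_biUnion, Finset.mem_univ, true_and, hmem]
    constructor
    · rintro ⟨i, h | h | h⟩
      · exact (hQpos i _ h).1
      · simpa using hS _ (hQpos i _ h).1
      · exact (hTzero i _ h).1
    · intro hx
      rcases lt_trichotomy x 0 with h | h | h
      · have hP' : -x ∈ P := Finset.mem_filter.2 ⟨hS x hx, by linarith⟩
        exact ⟨_, Or.inr (Or.inl ((hQmem _ _).2 ⟨hP', rfl⟩))⟩
      · obtain ⟨i, hi⟩ := hTcov x (Finset.mem_filter.2 ⟨hx, h⟩)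
        exact ⟨i, Or.inr (Or.inr hi)⟩
      · have hP' : x ∈ P := Finset.mem_filter.2 ⟨hx, h⟩
        exact ⟨_, Or.inl ((hQmem _ _).2 ⟨hP', rfl⟩)⟩

namespace SimpleGraph

variable {V : Type*} {T : SimpleGraph V} {w : V}

theorem exists_adj_mem_branchComponent (hT : T.Connected) (u : ({w}ᶜ : Set V)) :
    ∃ (v : V) (h : T.Adj w v), u ∈ (T.branchComponent h).supp := by
  have key : ∀ (x y : V) (p : T.Walk x y) (hy : y = w) (hx : x ≠ w), ∃ (v : V) (h : T.Adj w v),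
      (⟨x, hx⟩ : ({w}ᶜ : Set V)) ∈ (T.branchComponent h).supp := by
    intro x y p
    induction p with
    | nil => exact fun hy hx => absurd hy hx
    | @cons x x' y hadj p ih =>
      intro hy hx
      by_cases hx' : x' = w
      · subst hx'
        exact ⟨x, hadj.symm, rfl⟩
      · obtain ⟨v, h, hv⟩ := ih hy hx'
        refine ⟨v, h, ?_⟩
        rw [ConnectedComponent.mem_supp_iff] at hv ⊢
        rw [← hv, ConnectedComponent.eq]
        exact Adj.reachable (G := T.deleteVertex w) hadj
  obtain ⟨p⟩ := hT.preconnected u w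
  exact key u w p rfl u.2

theorem branchComponent_injective (hT : T.IsAcyclic) {v v' : V} (h : T.Adj w v) (h' : T.Adj w v')
    (heq : T.branchComponent h = T.branchComponent h') : v = v' := by
  by_contra hne
  have hb := isBridge_iff.1 (isAcyclic_iff_forall_adj_isBridge.1 hT h)
  let φ : T.deleteVertex w →g T.deleteEdges {s(w, v)} :=
    ⟨Subtype.val, fun {a b} hab => by
      rw [deleteEdges_adj]
      refine ⟨hab, fun hs => ?_⟩
      rcases Sym2.eq_iff.1 (Set.mem_singleton_iff.1 hs) with ⟨h1, _⟩ | ⟨_, h1⟩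
      · exact a.2 h1
      · exact b.2 h1⟩
  have h1 : (T.deleteEdges {s(w, v)}).Reachable v v' := (ConnectedComponent.eq.1 heq).map φ
  have h2 : (T.deleteEdges {s(w, v)}).Adj w v' := by
    rw [deleteEdges_adj]
    refine ⟨h', fun hs => ?_⟩
    rcases Sym2.eq_iff.1 (Set.mem_singleton_iff.1 hs) with ⟨_, h1⟩ | ⟨h1, _⟩
    · exact hne h1.symm
    · exact h.ne h1
  exact hb (h2.reachable.trans h1.symm)

theorem isTree_branch (hT : T.IsTree) {v : V} (h : T.Adj w v) : (T.branch h).IsTree :=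
  (hT.isAcyclic.induce _).isTree_connectedComponent _

theorem even_card_branch_of_oddComponents_eq_empty
    (hodd : (T.deleteVertex w).oddComponents = ∅) {v : V} (h : T.Adj w v) :
    Even (Nat.card (T.branchComponent h).supp) := by
  rw [Nat.card_coe_set_eq, ← Nat.not_odd_iff_even]
  intro ho
  have : T.branchComponent h ∈ (T.deleteVertex w).oddComponents := ho
  simp [hodd] at this

theorem exists_odd_card_branch_iff (hT : T.IsTree)
    (hodd : (T.deleteVertex w).oddComponents.ncard = 1) :
    ∃ v₀ : T.neighborSet w, ∀ v : T.neighborSet w,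
      Odd (Nat.card (T.branchComponent v.2).supp) ↔ v = v₀ := by
  obtain ⟨C, hC⟩ := Set.ncard_eq_one.1 hodd
  obtain ⟨u, hu⟩ := C.nonempty_supp
  obtain ⟨v₀, h₀, hv₀⟩ := exists_adj_mem_branchComponent hT.connected u
  have hC₀ : T.branchComponent h₀ = C := by
    rw [ConnectedComponent.mem_supp_iff] at hu hv₀
    rw [← hu, ← hv₀]
  refine ⟨⟨v₀, h₀⟩, fun v => ?_⟩
  have h1 : Odd (Nat.card (T.branchComponent v.2).supp) ↔ T.branchComponent v.2 = C := by
    rw [Nat.card_coe_set_eq, ← Set.mem_singleton_iff, ← hC]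
    rfl
  rw [h1, ← hC₀]
  refine ⟨fun h => Subtype.ext (branchComponent_injective hT.isAcyclic v.2 h₀ h), ?_⟩
  rintro rfl
  rfl

/-- A tree is its root `w` together with the branches at `w`. -/
noncomputable def branchEquiv (hT : T.IsTree) (w : V) :
    Unit ⊕ (Σ v : T.neighborSet w, (T.branchComponent v.2).supp) ≃ V :=
  Equiv.ofBijective (Sum.elim (fun _ => w) fun p => p.2.1.1) (by
    constructor
    · rintro (⟨⟩ | ⟨v, x⟩) (⟨⟩ | ⟨v', x'⟩) h
      · rfl
      · exact absurd h.symm x'.1.2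
      · exact absurd h x.1.2
      · have hx : x.1 = x'.1 := Subtype.ext h
        have hv : v = v' := by
          refine Subtype.ext (branchComponent_injective hT.isAcyclic v.2 v'.2 ?_)
          rw [← ConnectedComponent.mem_supp_iff _ _ |>.1 x.2,
            ← ConnectedComponent.mem_supp_iff _ _ |>.1 x'.2, hx]
        subst hv
        rw [Subtype.ext hx]
    · intro u
      by_cases hu : u = w
      · exact ⟨Sum.inl (), hu.symm⟩
      · obtain ⟨v, h, hv⟩ := exists_adj_mem_branchComponent hT.connected (w := w) ⟨u, hu⟩
        exact ⟨Sum.inr ⟨⟨v, h⟩, ⟨_, hv⟩⟩, rfl⟩)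

theorem adj_root_iff (hT : T.IsTree) {v : V} (h : T.Adj w v) (x : (T.branchComponent h).supp) :
    T.Adj w x.1.1 ↔ x = T.branchRoot h := by
  constructor
  · intro hx
    have : T.branchComponent hx = T.branchComponent h :=
      (ConnectedComponent.mem_supp_iff _ _).1 x.2
    exact Subtype.ext (Subtype.ext (branchComponent_injective hT.isAcyclic hx h this))
  · rintro rfl
    exact h

theorem branchComponent_eq_of_adj {v v' : V} (h : T.Adj w v) (h' : T.Adj w v')
    (x : (T.branchComponent h).supp) (x' : (T.branchComponent h').supp)
    (hadj : T.Adj x.1.1 x'.1.1) : T.branchComponent h = T.branchComponent h' := by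
  rw [← (ConnectedComponent.mem_supp_iff _ _).1 x.2, ← (ConnectedComponent.mem_supp_iff _ _).1 x'.2,
    ConnectedComponent.eq]
  exact Adj.reachable (G := T.deleteVertex w) hadj

theorem joinRoots_ne_zero_iff_adj [DecidableEq V] (hT : T.IsTree) {a : T.neighborSet w → ℝ}
    (ha : ∀ v, a v ≠ 0)
    {B : ∀ v : T.neighborSet w,
      Matrix (T.branchComponent v.2).supp (T.branchComponent v.2).supp ℝ}
    (hB : ∀ v x y, B v x y ≠ 0 ↔ (T.branch v.2).Adj x y)
    (p q : Unit ⊕ (Σ v : T.neighborSet w, (T.branchComponent v.2).supp)) :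
    Matrix.joinRoots (fun v => T.branchRoot v.2) a B p q ≠ 0 ↔
      T.Adj (branchEquiv hT w p) (branchEquiv hT w q) := by
  rcases p with ⟨⟩ | ⟨v, x⟩ <;> rcases q with ⟨⟩ | ⟨v', x'⟩
  · simp [Matrix.joinRoots]
  · refine Iff.trans ?_ (adj_root_iff hT v'.2 x').symm
    simp [Matrix.joinRoots, ha]
  · rw [adj_comm]
    refine Iff.trans ?_ (adj_root_iff hT v.2 x).symm
    simp [Matrix.joinRoots, ha]
  · rw [Matrix.joinRoots, Matrix.fromBlocks_apply₂₂]
    by_cases hv : v = v'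
    · subst hv
      rw [Matrix.blockDiagonal'_apply_eq, hB]
      rfl
    · rw [Matrix.blockDiagonal'_apply_ne _ _ _ hv]
      refine iff_of_false (by simp) fun h => hv ?_
      exact Subtype.ext (branchComponent_injective hT.isAcyclic v.2 v'.2
        (branchComponent_eq_of_adj v.2 v'.2 x x' h))

end SimpleGraph

theorem Complex.I_mul_sub_I_mul (y x : ℝ) :
    Complex.I * (y : ℂ) - Complex.I * x = Complex.I * ((y - x : ℝ) : ℂ) := by
  push_cast
  ring

theorem Complex.prod_I_mul_sub_I_mul {ι : Type*} (U : Finset ι) (f : ι → ℝ) (y : ℝ) :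
    ∏ x ∈ U, (Complex.I * (y : ℂ) - Complex.I * f x) =
      Complex.I ^ U.card * ((∏ x ∈ U, (y - f x) : ℝ) : ℂ) := by
  rw [Finset.prod_congr rfl fun x _ => Complex.I_mul_sub_I_mul y (f x), Finset.prod_mul_distrib,
    Finset.prod_const, Complex.ofReal_prod]

theorem Complex.sum_div_I_mul_sub_I_mul (U : Finset ℝ) (f : ℝ → ℝ) (y : ℝ) :
    ∑ x ∈ U, (f x : ℂ) / (Complex.I * (y : ℂ) - Complex.I * x) =
      -Complex.I * ((∑ x ∈ U, f x / (y - x) : ℝ) : ℂ) := by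
  rw [Complex.ofReal_sum, Finset.mul_sum]
  refine Finset.sum_congr rfl fun x _ => ?_
  rw [Complex.I_mul_sub_I_mul, div_mul_eq_div_div_swap, Complex.div_I, Complex.ofReal_div]
  ring

open Filter in
/-- Every tree that is NEB at `w` carries a skew-symmetric matrix whose resolvent entry at `w` is
prescribed by a symmetric probability measure with as many atoms as the tree has vertices. -/
theorem SimpleGraph.IsNEB.exists_skew_resolvent {V : Type*} {T : SimpleGraph V} {w : V}
    (h : T.IsNEB w) : ∀ [Fintype V] [DecidableEq V], T.IsTree → ∀ (S : Finset ℝ) (c : ℝ → ℝ),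
      S.card = Fintype.card V → (∀ x ∈ S, -x ∈ S) → (∀ x ∈ S, 0 < c x) → (∀ x ∈ S, c (-x) = c x) →
      ∑ x ∈ S, c x = 1 →
      ∃ A : Matrix V V ℝ, A.transpose = -A ∧ (∀ x y, A x y ≠ 0 ↔ T.Adj x y) ∧
        ∀ᶠ y : ℝ in cofinite,
          ((Complex.I * y) • (1 : Matrix V V ℂ) - A.map Complex.ofRealHom).det =
            ∏ x ∈ S, (Complex.I * y - Complex.I * x) ∧
          ((Complex.I * y) • (1 : Matrix V V ℂ) - A.map Complex.ofRealHom)⁻¹ w w =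
            ∑ x ∈ S, (c x : ℂ) / (Complex.I * y - Complex.I * x) := by
  induction h with
  | @single V T w hcard =>
    intro _ _ hT S c hS hneg hc hcs hc1
    rw [Nat.card_eq_fintype_card] at hcard
    have : Unique V := (Fintype.card_eq_one_iff_nonempty_unique.1 hcard).some
    rw [hcard, Finset.card_eq_one] at hS
    obtain ⟨x, rfl⟩ := hS
    have hx : x = 0 := by
      have := hneg x (by simp)
      rw [Finset.mem_singleton] at this
      linarith
    subst hx
    rw [Finset.sum_singleton] at hc1
    refine ⟨0, by simp, fun x y => ?_, Eventually.of_forall fun y => ⟨?_, ?_⟩⟩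
    · simp [Subsingleton.elim x y]
    · simp [Matrix.det_unique]
    · rw [Matrix.inv_subsingleton]
      simp [hc1]
  | @branching V T w hcard heven hodd hbr ih =>
    intro _ _ hT S c hS hneg hc hcs hc1
    classical
    have hne : S.Nonempty := by
      rw [← Finset.card_pos, hS]
      exact Fintype.card_pos_iff.2 ⟨w⟩
    obtain ⟨S', d, hS'card, hS'neg, hd, hds, hres⟩ :=
      Finset.exists_inv_resolvent hne hneg hc hcs hc1
    have hVcard : Fintype.card V = 1 + ∑ v : T.neighborSet w,
        Fintype.card (T.branchComponent v.2).supp := by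
      rw [← Fintype.card_congr (branchEquiv hT w), Fintype.card_sum, Fintype.card_sigma,
        Fintype.card_unit]
    rw [Nat.card_eq_fintype_card] at hcard heven hodd
    obtain ⟨P, hPcard, hPneg, hPdisj, hPun⟩ := Finset.exists_symmetric_coloring
      (fun v : T.neighborSet w => Fintype.card (T.branchComponent v.2).supp) hS'neg (by omega)
      (fun ho => by
        obtain ⟨v₀, hv₀⟩ := exists_odd_card_branch_iff hT
          (heven (by rw [← hS, ← hS'card]; exact ho.add_one))
        exact ⟨v₀, fun v => by rw [← hv₀, Nat.card_eq_fintype_card]⟩)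
      (fun he v => by
        rw [← Nat.card_eq_fintype_card]
        exact even_card_branch_of_oddComponents_eq_empty
          (hodd (by rw [← hS, ← hS'card]; exact he.add_one)) v.2)
    have hsum : ∀ f : ℝ → ℂ, ∑ v, ∑ x ∈ P v, f x = ∑ x ∈ S', f x := fun f => by
      rw [← hPun, Finset.sum_biUnion]
      simpa using hPdisj
    have hprod : ∀ f : ℝ → ℂ, ∏ v, ∏ x ∈ P v, f x = ∏ x ∈ S', f x := fun f => by
      rw [← hPun, Finset.prod_biUnion]
      simpa using hPdisj
    have hPsub : ∀ v, P v ⊆ S' := fun v => by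
      rw [← hPun]
      exact Finset.subset_biUnion_of_mem P (Finset.mem_univ v)
    set D : T.neighborSet w → ℝ := fun v => ∑ x ∈ P v, d x with hD
    have hDpos : ∀ v, 0 < D v := fun v => by
      refine Finset.sum_pos (fun x hx => hd x (hPsub v hx)) ?_
      rw [← Finset.card_pos, hPcard]
      exact Fintype.card_pos_iff.2 ⟨T.branchRoot v.2⟩
    have hex := fun v : T.neighborSet w => ih v.1 v.2 (isTree_branch hT v.2) (P v)
      (fun x => d x / D v) (hPcard v) (hPneg v)
      (fun x hx => div_pos (hd x (hPsub v hx)) (hDpos v)) (fun x _ => by rw [hds])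
      (by rw [← Finset.sum_div, div_self (hDpos v).ne'])
    choose B hBskew hBadj hBres using hex
    set a : T.neighborSet w → ℝ := fun v => √(D v) with ha
    have ha0 : ∀ v, a v ≠ 0 := fun v => (Real.sqrt_pos.2 (hDpos v)).ne'
    have ha2 : ∀ v, a v ^ 2 = D v := fun v => Real.sq_sqrt (hDpos v).le
    set e := branchEquiv hT w with he
    set M := Matrix.joinRoots (fun v : T.neighborSet w => T.branchRoot v.2) a B with hM
    refine ⟨M.submatrix e.symm e.symm, ?_, fun x y => ?_, ?_⟩
    · rw [Matrix.transpose_submatrix, hM, Matrix.joinRoots_transpose hBskew]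
      rfl
    · rw [Matrix.submatrix_apply, hM, joinRoots_ne_zero_iff_adj hT ha0 hBadj, ← he,
        e.apply_symm_apply, e.apply_symm_apply]
    · have hBres' : ∀ᶠ y : ℝ in cofinite, ∀ v, _ := eventually_all.2 hBres
      filter_upwards [hBres', S.finite_toSet.compl_mem_cofinite,
        S'.finite_toSet.compl_mem_cofinite] with y hy hyS hyS'
      have hyS0 : y ∉ S := hyS
      have hyS'0 : y ∉ S' := hyS'
      obtain ⟨h1, h2⟩ := hres y hyS0 hyS'0
      have hp0 : ∏ x ∈ S, (y - x) ≠ 0 :=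
        Finset.prod_ne_zero_iff.2 fun x hx => sub_ne_zero.2 fun h => hyS0 (h ▸ hx)
      have hp0' : ∏ x ∈ S', (y - x) ≠ 0 :=
        Finset.prod_ne_zero_iff.2 fun x hx => sub_ne_zero.2 fun h => hyS'0 (h ▸ hx)
      set s : ℂ := Complex.I * (((∏ x ∈ S, (y - x)) / ∏ x ∈ S', (y - x) : ℝ) : ℂ) with hs
      have hs0 : s ≠ 0 :=
        mul_ne_zero Complex.I_ne_zero (Complex.ofReal_ne_zero.2 (div_ne_zero hp0 hp0'))
      have hssum : s = Complex.I * y + ∑ v, (a v : ℂ) ^ 2 *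
          ((Complex.I * y) • (1 : Matrix (T.branchComponent v.2).supp
            (T.branchComponent v.2).supp ℂ) - (B v).map Complex.ofRealHom)⁻¹
            (T.branchRoot v.2) (T.branchRoot v.2) := by
        have h3 : ∀ v, (a v : ℂ) ^ 2 *
          ((Complex.I * y) • (1 : Matrix (T.branchComponent v.2).supp
            (T.branchComponent v.2).supp ℂ) - (B v).map Complex.ofRealHom)⁻¹
            (T.branchRoot v.2) (T.branchRoot v.2) =
            ∑ x ∈ P v, (d x : ℂ) / (Complex.I * (y : ℂ) - Complex.I * x) := by
          intro v
          rw [(hy v).2, ← Complex.ofReal_pow, ha2, Finset.mul_sum]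
          refine Finset.sum_congr rfl fun x _ => ?_
          have : (D v : ℂ) ≠ 0 := Complex.ofReal_ne_zero.2 (hDpos v).ne'
          rw [Complex.ofReal_div, ← mul_div_assoc, mul_div_cancel₀ _ this]
        rw [Finset.sum_congr rfl fun v _ => h3 v,
          hsum (fun x => (d x : ℂ) / (Complex.I * (y : ℂ) - Complex.I * x)), Complex.sum_div_I_mul_sub_I_mul, hs, ← h2]
        push_cast
        ring
      have hBdet : ∀ v, ((Complex.I * y) • (1 : Matrix (T.branchComponent v.2).supp
            (T.branchComponent v.2).supp ℂ) - (B v).map Complex.ofRealHom).det ≠ 0 := by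
        intro v
        rw [(hy v).1, Finset.prod_ne_zero_iff]
        intro x hx
        rw [Complex.I_mul_sub_I_mul]
        exact mul_ne_zero Complex.I_ne_zero (Complex.ofReal_ne_zero.2
          (sub_ne_zero.2 fun h => hyS'0 (h ▸ hPsub v hx)))
      obtain ⟨hdet, hinv⟩ := Matrix.det_and_inv_smul_one_sub_joinRoots (Complex.I * y) hBdet hssum
      have hmat : (Complex.I * y) • (1 : Matrix V V ℂ) -
          (M.submatrix e.symm e.symm).map Complex.ofRealHom =
          ((Complex.I * y) • 1 - Matrix.joinRoots (fun v : T.neighborSet w => T.branchRoot v.2)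
            (fun v => (a v : ℂ)) fun v => (B v).map Complex.ofRealHom).submatrix
            e.symm e.symm := by
        refine Eq.trans ?_ (congrArg
          (fun N => ((Complex.I * (y : ℂ)) • 1 - N).submatrix e.symm e.symm)
          (Matrix.joinRoots_map Complex.ofRealHom))
        rw [← Matrix.submatrix_one_equiv (α := ℂ) e.symm]
        rfl
      rw [hmat, Matrix.det_submatrix_equiv_self, Matrix.inv_submatrix_equiv,
        Matrix.submatrix_apply]
      have hew : e.symm w = Sum.inl () := e.symm_apply_eq.2 rfl
      rw [hew, hdet, hinv hs0, Complex.prod_I_mul_sub_I_mul S (fun x => x), Complex.sum_div_I_mul_sub_I_mul]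
      constructor
      · rw [Finset.prod_congr rfl fun v _ => (hy v).1,
          hprod fun x => Complex.I * (y : ℂ) - Complex.I * x, 
          Complex.prod_I_mul_sub_I_mul S' (fun x => x), ← hS'card, hs, pow_succ,
          Complex.ofReal_div]
        have := Complex.ofReal_ne_zero.2 hp0'
        field_simp
      · rw [hs, h1, mul_inv, Complex.inv_I, ← Complex.ofReal_inv, inv_div]

open Polynomial in
theorem Polynomial.eq_of_eventually_eval_I_mul_eq {p q : ℂ[X]}
    (h : ∀ᶠ y : ℝ in Filter.cofinite, p.eval (Complex.I * y) = q.eval (Complex.I * y)) :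
    p = q := by
  refine Polynomial.eq_of_infinite_eval_eq p q ?_
  have h1 : {y : ℝ | p.eval (Complex.I * y) = q.eval (Complex.I * y)}.Infinite :=
    Filter.frequently_cofinite_iff_infinite.1 h.frequently
  refine (h1.image (f := fun y : ℝ => Complex.I * (y : ℂ)) ?_).mono ?_
  · intro y _ y' _ hyy
    exact Complex.ofReal_injective (mul_left_cancel₀ Complex.I_ne_zero hyy)
  · rintro _ ⟨y, hy, rfl⟩
    exact hy

/-- The eigenvalues of a real matrix are determined by its characteristic determinant on all but
finitely many points of the imaginary axis. -/
theorem Matrix.complexEigenvalues_eq_of_eventually {V ι : Type*} [Fintype V] [DecidableEq V]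
    [Fintype ι] (A : Matrix V V ℝ) (f : ι → ℝ)
    (h : ∀ᶠ y : ℝ in Filter.cofinite,
      ((Complex.I * y) • (1 : Matrix V V ℂ) - A.map Complex.ofRealHom).det =
        ∏ j, (Complex.I * (y : ℂ) - Complex.I * f j)) :
    A.complexEigenvalues = (Finset.univ : Finset ι).val.map fun j => Complex.I * (f j : ℂ) := by
  have hp : (A.map Complex.ofReal).charpoly =
      (((Finset.univ : Finset ι).val.map fun j => Complex.I * (f j : ℂ)).map
        fun a => Polynomial.X - Polynomial.C a).prod := by
    refine Polynomial.eq_of_eventually_eval_I_mul_eq ?_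
    filter_upwards [h] with y hy
    rw [Matrix.eval_charpoly, Matrix.scalar_apply, ← Matrix.smul_one_eq_diagonal, Multiset.map_map]
    change _ = Polynomial.eval _ (∏ j, (Polynomial.X - Polynomial.C (Complex.I * (f j : ℂ))))
    rw [Polynomial.eval_prod]
    simp only [Polynomial.eval_sub, Polynomial.eval_X, Polynomial.eval_C]
    exact hy
  rw [Matrix.complexEigenvalues, hp, Polynomial.roots_multiset_prod_X_sub_C]

theorem Finset.prod_erase_neg_sub {S : Finset ℝ} (hS : ∀ x ∈ S, -x ∈ S) (x : ℝ) :
    ∏ x' ∈ S.erase (-x), (-x - x') = (-1) ^ (S.erase x).card * ∏ x' ∈ S.erase x, (x - x') := by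
  rw [← Finset.prod_const, ← Finset.prod_mul_distrib]
  refine Finset.prod_bij' (fun x _ => -x) (fun x _ => -x) ?_ ?_ (by simp) (by simp) ?_
  · intro a ha
    rw [Finset.mem_erase] at ha ⊢
    exact ⟨fun h => ha.1 (by rw [← h, neg_neg]), hS a ha.2⟩
  · intro a ha
    rw [Finset.mem_erase] at ha ⊢
    exact ⟨fun h => ha.1 (neg_injective h), hS a ha.2⟩
  · intro a _
    ring

theorem Fin.prod_neg_sub_of_eq_neg_rev {m : ℕ} {mu : Fin m → ℝ} (hmu : ∀ k, mu k = -mu k.rev)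
    (x : ℝ) : ∏ k, (-x - mu k) = (-1) ^ m * ∏ k, (x - mu k) := by
  rw [← Equiv.prod_comp Fin.revPerm]
  have : ∀ k : Fin m, -x - mu (Fin.revPerm k) = -1 * (x - mu k) := fun k => by
    rw [Fin.revPerm_apply, hmu k]
    ring
  rw [Finset.prod_congr rfl fun k _ => this k, Finset.prod_mul_distrib]
  simp

/-- For strictly interlacing sequences, `∏ (X - mu k)` and the derivative of `∏ (X - lam i)` have
the same sign at every `lam j`. -/
theorem Fin.prod_sub_div_prod_erase_sub_pos {m : ℕ} {lam : Fin (m + 1) → ℝ} {mu : Fin m → ℝ}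
    (hinter : ∀ k : Fin m, lam k.castSucc < mu k ∧ mu k < lam k.succ) (hlam : StrictMono lam)
    (j : Fin (m + 1)) :
    0 < (∏ k, (lam j - mu k)) / ∏ i ∈ Finset.univ.erase j, (lam j - lam i) := by
  have h1 : ∏ i ∈ Finset.univ.erase j, (lam j - lam i) =
      ∏ k : Fin m, (lam j - lam (j.succAbove k)) := by
    rw [← Finset.compl_singleton, ← Fin.image_succAbove_univ, Finset.prod_image]
    exact fun a _ b _ h => Fin.succAbove_right_injective h
  rw [h1, ← Finset.prod_div_distrib]
  refine Finset.prod_pos fun k _ => ?_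
  obtain ⟨hk1, hk2⟩ := hinter k
  rcases lt_or_ge k.castSucc j with h | h
  · rw [Fin.succAbove_of_castSucc_lt _ _ h]
    have := hlam.monotone (Fin.castSucc_lt_iff_succ_le.1 h)
    have := hlam h
    exact div_pos (by linarith) (by linarith)
  · rw [Fin.succAbove_of_le_castSucc _ _ h]
    have := hlam.monotone h
    exact div_pos_of_neg_of_neg (by linarith) (by linarith)

/-- Here `n = m + 1`, the reals are `lam 0 < mu 0 < lam 1 < ⋯ < mu (m - 1) < lam m`, and `Fin.rev`
reverses the order of the indices. -/
theorem theorem3p1 {V : Type*} [Fintype V] [DecidableEq V] (m : ℕ)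
    (hm : 2 ≤ m + 1) (hV : Fintype.card V = m + 1)
    (T : SimpleGraph V) (hT : T.IsTree) (v : V) (hv : T.IsNEB v)
    (lam : Fin (m + 1) → ℝ) (mu : Fin m → ℝ)
    (hinter : ∀ k : Fin m, lam k.castSucc < mu k ∧ mu k < lam k.succ)
    (hlam : ∀ j : Fin (m + 1), lam j = -lam j.rev)
    (hmu : ∀ k : Fin m, mu k = -mu k.rev) :
    ∃ A ∈ T.skewMatrices,
      A.complexEigenvalues =
        (Finset.univ : Finset (Fin (m + 1))).val.map (fun j => Complex.I * (lam j : ℂ)) ∧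
      (A.deleteIndex v).complexEigenvalues =
        (Finset.univ : Finset (Fin m)).val.map (fun k => Complex.I * (mu k : ℂ)) := by
  have hmono : StrictMono lam :=
    Fin.strictMono_iff_lt_succ.2 fun k => (hinter k).1.trans (hinter k).2
  set S : Finset ℝ := Finset.univ.map ⟨lam, hmono.injective⟩ with hS
  have hScard : S.card = m + 1 := by simp [hS]
  have hSneg : ∀ x ∈ S, -x ∈ S := by
    intro x hx
    obtain ⟨j, _, rfl⟩ := Finset.mem_map.1 hx
    exact Finset.mem_map.2 ⟨j.rev, Finset.mem_univ _, by simp [hlam j]⟩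
  set c : ℝ → ℝ := fun x => (∏ k, (x - mu k)) / ∏ x' ∈ S.erase x, (x - x') with hc
  have hcpos : ∀ x ∈ S, 0 < c x := by
    intro x hx
    obtain ⟨j, _, rfl⟩ := Finset.mem_map.1 hx
    have h := Fin.prod_sub_div_prod_erase_sub_pos hinter hmono j
    rw [hc, hS]
    beta_reduce
    rw [← Finset.map_erase, Finset.prod_map]
    exact h
  have hcneg : ∀ x ∈ S, c (-x) = c x := by
    intro x hx
    rw [hc]
    beta_reduce
    rw [Finset.prod_erase_neg_sub hSneg, Fin.prod_neg_sub_of_eq_neg_rev hmu,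
      Finset.card_erase_of_mem hx, hScard, Nat.add_sub_cancel, mul_div_mul_left]
    exact pow_ne_zero _ (by norm_num)
  set g : Polynomial ℝ := ∏ k, (Polynomial.X - Polynomial.C (mu k)) with hg
  have hgeval : ∀ y, g.eval y = ∏ k, (y - mu k) := fun y => by
    rw [hg, Polynomial.eval_prod]
    simp
  have hgm : g.Monic := Polynomial.monic_prod_of_monic _ _ fun k _ => Polynomial.monic_X_sub_C _
  have hgdeg : g.degree = m := by
    rw [hg, Polynomial.degree_prod]
    simp
  have hcsum : ∑ x ∈ S, c x = 1 := by
    have h := Lagrange.leadingCoeff_eq_sum (s := S) (v := id) (P := g) (Set.injOn_id _)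
      (by rw [hgdeg, hScard]; rfl)
    rw [hgm.leadingCoeff] at h
    rw [h]
    exact Finset.sum_congr rfl fun x _ => by rw [id, hgeval]; rfl
  obtain ⟨A, hAskew, hAadj, hAres⟩ := hv.exists_skew_resolvent hT S c (by rw [hScard, hV]) hSneg
    hcpos hcneg hcsum
  refine ⟨A, ⟨hAskew, ?_⟩, ?_, ?_⟩
  · ext x y
    rw [Matrix.graphOf, SimpleGraph.fromRel_adj, hAadj, hAadj, T.adj_comm y x, or_self]
    exact ⟨fun h => h.2, fun h => ⟨h.ne, h⟩⟩
  · refine Matrix.complexEigenvalues_eq_of_eventually A lam ?_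
    filter_upwards [hAres] with y hy
    rw [hy.1, hS, Finset.prod_map]
    rfl
  · refine Matrix.complexEigenvalues_eq_of_eventually _ mu ?_
    filter_upwards [hAres, S.finite_toSet.compl_mem_cofinite] with y hy hyS
    have hyS0 : y ∉ S := hyS
    set M := (Complex.I * (y : ℂ)) • (1 : Matrix V V ℂ) - A.map Complex.ofRealHom with hM
    have hdet : M.det ≠ 0 := by
      rw [hy.1, Finset.prod_ne_zero_iff]
      intro x hx
      rw [Complex.I_mul_sub_I_mul]
      exact mul_ne_zero Complex.I_ne_zero (Complex.ofReal_ne_zero.2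
        (sub_ne_zero.2 fun h => hyS0 (h ▸ hx)))
    have hdel : (Complex.I * (y : ℂ)) • (1 : Matrix {i : V // i ≠ v} {i : V // i ≠ v} ℂ) -
        (A.deleteIndex v).map Complex.ofRealHom = M.deleteIndex v := by
      rw [← Matrix.submatrix_one (α := ℂ) (Subtype.val : {i : V // i ≠ v} → V)
        Subtype.val_injective]
      rfl
    rw [hdel, Matrix.det_deleteIndex M hdet, hy.1, hy.2,
      Complex.prod_I_mul_sub_I_mul S (fun x => x), Complex.sum_div_I_mul_sub_I_mul,
      Complex.prod_I_mul_sub_I_mul, ← hgeval,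
      Polynomial.eval_eq_prod_mul_sum_div (S := S) (p := g)
        (by rw [hgdeg, hScard]; exact_mod_cast Nat.lt_succ_self m) hyS0, hScard, pow_succ,
      Finset.card_univ, Fintype.card_fin, Complex.ofReal_mul]
    simp only [hgeval]
    linear_combination (-(Complex.I ^ m) * ((∏ x ∈ S, (y - x) : ℝ) : ℂ) *
      ((∑ x ∈ S, c x / (y - x) : ℝ) : ℂ)) * Complex.I_sq
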